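/- A game (with colors and states) is a tuple $g=\langle A_1,A_2,Q,q_0,\delta,C,\mathrm{col},W\rangle$ with non-empty sets $A_1,A_2$ of actions of Player 1 and Player 2, a set $Q$ of states with initial state $q_0\in Q$, a state update function $\delta:Q\times A_1\times A_2\to Q$, a set $C$ of colors, a coloring $\mathrm{col}:Q\times A_1\times A_2\to C$, and a winning condition $W\subseteq C^\omega$. A run $(a_n,b_n)_{n\in\mathbb N}\in(A_1\times A_2)^\omega$ visits the states $q_0$, $q_{n+1}=\delta(q_n,a_n,b_n)$ and has the trace $(\mathrm{col}(q_n,a_n,b_n))_{n\in\mathbb N}$. A Player 1 strategy is a map $s:A_2^*\to A_1$; it is winning if for every $(b_n)_n\in A_2^\omega$ the run with $a_n=s(b_0\cdots b_{n-1})$ has its trace in $W$. A Player 2 strategy is a map $t:A_1^*\to A_2$; it is winning if for every $(a_n)_n\in A_1^\omega$ the run with $b_n=t(a_0\cdots a_{n-1})$ has its trace outside $W$, and it is positional if there is $\tau:Q\to A_2$ such that $b_n=\tau(q_n)$ for all $n$ in all these runs. The game is turn-based if at every state $q\in Q$ the pair $(\mathrm{col},\delta)(q,a,b)$ depends only on $a$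 or only on $b$. Let $g$ be a turn-based game with finite $Q$ and finite $C$ ($A_1$ and $A_2$ may be infinite), whose winning condition $W$ is a safety-mean-payoff-parity condition, that is: for some set $S\subseteq C$ of safe colors, some rewards $r:C\to\mathbb R$ and some priorities $p:C\to\mathbb N$, a sequence $(c_n)_{n\in\mathbb N}\in C^\omega$ is in $W$ if and only if 1. (safety) $c_n\in S$ for all $n\in\mathbb N$, 2. (mean-payoff) $\limsup_{n\to\infty}\frac1n\sum_{i=0}^n r(c_i)\ge 0$, and 3. (parity) the least number that occurs infinitely many times in $(p(c_n))_{n\in\mathbb N}$ is even. Then $g$ is half-positionally determined: either Player 1 has a winning strategy, or Player 2 has a positional winning strategy. -/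

import Mathlib

open Filter

/-- A two-player game with colors and states. Infinite words over `X` are functions `ℕ → X`;
`W` is the winning condition of Player 1, and Player 2 wins the plays whose trace is not in `W`. -/
structure ColorGame (A₁ A₂ Q C : Type*) where
  /-- the initial state -/
  q₀ : Q
  /-- the state update function -/
  δ : Q → A₁ → A₂ → Q
  /-- the color trace -/
  col : Q → A₁ → A₂ → C
  /-- the winning condition -/
  W : Set (ℕ → C)

/-- The prefix of length `n` of an infinite word. -/
def wordPrefix {X : Type*} (u : ℕ → X) (n : ℕ) : List X :=
  (List.range n).map u

/-- The full run induced by a Player 1 strategy and a Player 2 run. -/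
def runOfStrategy₁ {A₁ A₂ : Type*} (s : List A₂ → A₁) (β : ℕ → A₂) : ℕ → A₁ × A₂ :=
  fun n => (s (wordPrefix β n), β n)

/-- The full run induced by a Player 2 strategy and a Player 1 run. -/
def runOfStrategy₂ {A₁ A₂ : Type*} (t : List A₁ → A₂) (α : ℕ → A₁) : ℕ → A₁ × A₂ :=
  fun n => (α n, t (wordPrefix α n))

namespace ColorGame

variable {A₁ A₂ Q C : Type*} (g : ColorGame A₁ A₂ Q C)

/-- The state reached after the first `n` rounds of a full run. -/
def stateAt (ρ : ℕ → A₁ × A₂) : ℕ → Q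
  | 0 => g.q₀
  | n + 1 => g.δ (stateAt ρ n) (ρ n).1 (ρ n).2

/-- The infinite color trace of a full run. -/
def trace (ρ : ℕ → A₁ × A₂) : ℕ → C :=
  fun n => g.col (g.stateAt ρ n) (ρ n).1 (ρ n).2

/-- A Player 1 strategy is winning if every run compatible with it has its trace in `W`. -/
def Winning₁ (s : List A₂ → A₁) : Prop :=
  ∀ β : ℕ → A₂, g.trace (runOfStrategy₁ s β) ∈ g.W

/-- A Player 2 strategy is winning if no run compatible with it has its trace in `W`. -/
def Winning₂ (t : List A₁ → A₂) : Prop :=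
  ∀ α : ℕ → A₁, g.trace (runOfStrategy₂ t α) ∉ g.W

/-- A Player 2 strategy is positional if its choice depends on the current state only. -/
def Positional₂ (t : List A₁ → A₂) : Prop :=
  ∃ τ : Q → A₂, ∀ (α : ℕ → A₁) (n : ℕ),
    t (wordPrefix α n) = τ (g.stateAt (runOfStrategy₂ t α) n)

/-- Only Player 1's action matters at the state `q`. -/
def ControlledBy₁ (q : Q) : Prop :=
  ∀ (a : A₁) (b b' : A₂), g.δ q a b = g.δ q a b' ∧ g.col q a b = g.col q a b'

/-- Only Player 2's action matters at the state `q`. -/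
def ControlledBy₂ (q : Q) : Prop :=
  ∀ (a a' : A₁) (b : A₂), g.δ q a b = g.δ q a' b ∧ g.col q a b = g.col q a' b

/-- The game encodes a turn-based game: each state is controlled by one of the players. -/
def IsTurnBased : Prop :=
  ∀ q : Q, g.ControlledBy₁ q ∨ g.ControlledBy₂ q

/-- Either Player 1 has a winning strategy or Player 2 has a positional winning strategy. -/
def HalfPositionallyDetermined : Prop :=
  (∃ s : List A₂ → A₁, g.Winning₁ s) ∨
    ∃ t : List A₁ → A₂, g.Positional₂ t ∧ g.Winning₂ t

end ColorGame

/-- Safety: only elements of the safe set `S` occur. -/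
def safetyCondition {C : Type*} (S : Set C) : Set (ℕ → C) :=
  {u | ∀ n, u n ∈ S}

/-- Parity: the least number occurring infinitely many times exists and is even. -/
def parityCondition : Set (ℕ → ℕ) :=
  {u | ∃ k, IsLeast {m | ∃ᶠ i in atTop, u i = m} k ∧ Even k}

/-- Mean-payoff: the limit superior of the averages, taken in the extended reals,
is non-negative. -/
noncomputable def meanPayoffCondition : Set (ℕ → ℝ) :=
  {u | 0 ≤ limsup
    (fun n : ℕ => (((1 / (n : ℝ)) * ∑ i ∈ Finset.range (n + 1), u i : ℝ) : EReal)) atTop}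

/-- The conjunction of the safety condition with safe colors `S`, the mean-payoff condition on
the rewards `r` of the colors and the parity condition on their priorities `p`. -/
noncomputable def safetyMeanPayoffParity {C : Type*} (S : Set C) (r : C → ℝ) (p : C → ℕ) :
    Set (ℕ → C) :=
  {u | u ∈ safetyCondition S ∧ r ∘ u ∈ meanPayoffCondition ∧ p ∘ u ∈ parityCondition}

/-! On safe words the winning condition lies between two others: `GoodInf` (limit inferior of the
averages) implies it, and it implies `GoodSup`. Each player is given the harder task: Player 1 has
to ensure `GoodInf`, Player 2 to prevent `GoodSup`. This pays off because `GoodInf` is closed under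
shuffles (`GoodInf.shuffle`), which the limit superior is not. The gap is closed where only one
player has choices: in a finite graph, a `GoodSup` path has closed segments of almost non-negative
average at a fixed vertex, and repeating better and better ones slowly enough gives a `GoodInf` path
(`exists_goodInf_path`).

`wins₁_or_wins₂` inducts on the number of moves. If some vertex `x` of Player 2 has two moves, its
moves are split into two nonempty parts, giving two smaller games. A positional win of Player 2 from
`q` in either one carries over. Otherwise Player 1 wins both from `q`. If Player 1 also wins the
second from `x`, the plays of the whole game are shuffles of plays of the two games
(`Wins₁.combine`); if not, the strategy winning the second from `q` never meets `x`, so the split is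
irrelevant (`Wins₁.of_wins₂`).

Safety becomes a losing sink. Moves are pairs of a color and a state, so the graph is finite even
for infinite action sets. -/

/-- The least value of `p` seen infinitely often along `c` is even. -/
def EvenLeast {L : Type*} (p : L → ℕ) (c : ℕ → L) : Prop :=
  ∃ k, Even k ∧ (∃ᶠ i in atTop, p (c i) = k) ∧ ∀ᶠ i in atTop, k ≤ p (c i)

/-- Non-negative limit inferior of the averages, and the parity condition. -/
def GoodInf {L : Type*} (r : L → ℝ) (p : L → ℕ) (c : ℕ → L) : Prop :=
  (∀ ε : ℝ, 0 < ε → ∃ K : ℝ, ∀ n : ℕ, -ε * n - K ≤ ∑ i ∈ Finset.range n, r (c i)) ∧ EvenLeast p c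

/-- Non-negative limit superior of the averages, and the parity condition. -/
def GoodSup {L : Type*} (r : L → ℝ) (p : L → ℕ) (c : ℕ → L) : Prop :=
  (∀ ε : ℝ, 0 < ε → ∃ᶠ n : ℕ in atTop, -ε * n ≤ ∑ i ∈ Finset.range n, r (c i)) ∧ EvenLeast p c

/-! ### Shuffles of sequences -/

section Sequences

variable {L : Type*} {r : L → ℝ} {p : L → ℕ} {c : ℕ → L}

theorem GoodInf.goodSup (h : GoodInf r p c) : GoodSup r p c := by
  refine ⟨fun ε hε => ?_, h.2⟩
  obtain ⟨K, hK⟩ := h.1 (ε / 2) (half_pos hε)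
  obtain ⟨N, hN⟩ := exists_nat_ge (K / (ε / 2))
  refine Eventually.frequently (eventually_atTop.2 ⟨N, fun n hn => ?_⟩)
  have h1 : K ≤ ε / 2 * n := by
    rw [div_le_iff₀' (half_pos hε)] at hN
    exact hN.trans (by gcongr)
  linarith [hK n]

theorem EvenLeast.tail (h : EvenLeast p c) : EvenLeast p fun n => c (n + 1) := by
  obtain ⟨k, hk, h1, h2⟩ := h
  refine ⟨k, hk, ?_, (tendsto_add_atTop_nat 1).eventually h2⟩
  rw [frequently_atTop] at h1 ⊢
  intro a
  obtain ⟨b, hb, hb'⟩ := h1 (a + 1)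
  exact ⟨b - 1, by omega, by
    simpa only [Nat.sub_add_cancel (by omega : 1 ≤ b)] using hb'⟩

theorem GoodInf.tail (h : GoodInf r p c) : GoodInf r p fun n => c (n + 1) := by
  refine ⟨fun ε hε => ?_, h.2.tail⟩
  obtain ⟨K, hK⟩ := h.1 ε hε
  refine ⟨K + ε + r (c 0), fun n => ?_⟩
  have := hK (n + 1)
  rw [Finset.sum_range_succ'] at this
  push_cast at this
  linarith

theorem sum_filter_eq_sum_nth (f : ℕ → ℝ) {T : ℕ → Prop} [DecidablePred T] (n : ℕ) :
    ∑ i ∈ Finset.range n with T i, f i =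
      ∑ k ∈ Finset.range (Nat.count T n), f (Nat.nth T k) := by
  induction n with
  | zero => simp
  | succ n ih =>
    rw [Finset.range_add_one, Finset.filter_insert, Nat.count_succ]
    split_ifs with h
    · rw [Finset.sum_insert (by simp), Finset.sum_range_succ, Nat.nth_count h, ih, add_comm]
    · simpa using ih

/-- A subsequence is no longer than the whole, so its bound in its own length is also one in `n`; a
finite part is absorbed by the constant. -/
theorem exists_lower_bound_filter {T : ℕ → Prop} [DecidablePred T]
    (h : {n | T n}.Infinite → GoodInf r p fun k => c (Nat.nth T k)) (ε : ℝ) (hε : 0 < ε) :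
    ∃ K : ℝ, ∀ n : ℕ, -ε * n - K ≤ ∑ i ∈ Finset.range n with T i, r (c i) := by
  by_cases hT : {n | T n}.Infinite
  · obtain ⟨K, hK⟩ := (h hT).1 ε hε
    refine ⟨K, fun n => ?_⟩
    rw [sum_filter_eq_sum_nth fun i => r (c i)]
    refine le_trans ?_ (hK _)
    have : (Nat.count T n : ℝ) ≤ n := Nat.cast_le.2 (Nat.count_le (p := T))
    nlinarith
  · have hT := Set.not_infinite.1 hT
    refine ⟨∑ i ∈ hT.toFinset, |r (c i)|, fun n => ?_⟩
    have h1 : |∑ i ∈ Finset.range n with T i, r (c i)| ≤ ∑ i ∈ hT.toFinset, |r (c i)| := by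
      refine (Finset.abs_sum_le_sum_abs _ _).trans
        (Finset.sum_le_sum_of_subset_of_nonneg ?_ fun _ _ _ => abs_nonneg _)
      intro i hi
      simpa using (Finset.mem_filter.1 hi).2
    have h2 := (abs_le.1 h1).1
    have h3 : 0 ≤ ε * n := by positivity
    linarith

theorem EvenLeast.of_nth {T : ℕ → Prop} (hT : {n | T n}.Infinite)
    (h : EvenLeast p fun k => c (Nat.nth T k)) :
    ∃ k, Even k ∧ (∃ᶠ i in atTop, p (c i) = k) ∧ ∀ᶠ i in atTop, T i → k ≤ p (c i) := by
  classical
  obtain ⟨k, hk, h1, h2⟩ := h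
  refine ⟨k, hk, (Nat.nth_strictMono hT).tendsto_atTop.frequently h1, ?_⟩
  obtain ⟨N, hN⟩ := eventually_atTop.1 h2
  refine eventually_atTop.2 ⟨Nat.nth T N, fun i hi hTi => ?_⟩
  have := hN (Nat.count T i) ((Nat.le_nth_count hT _ |>.trans' hi) |> (Nat.nth_le_nth hT).1)
  simpa [Nat.nth_count hTi] using this

/-- The least recurring value of a shuffle is the smaller of those of its infinite parts, hence
even. -/
theorem EvenLeast.shuffle {T : ℕ → Prop}
    (h₁ : {n | T n}.Infinite → EvenLeast p fun k => c (Nat.nth T k))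
    (h₂ : {n | ¬ T n}.Infinite → EvenLeast p fun k => c (Nat.nth (fun n => ¬ T n) k)) :
    EvenLeast p c := by
  by_cases i₁ : {n | T n}.Infinite
  · obtain ⟨k, hk, hf, he⟩ := (h₁ i₁).of_nth i₁
    by_cases i₂ : {n | ¬ T n}.Infinite
    · obtain ⟨k', hk', hf', he'⟩ := (h₂ i₂).of_nth i₂
      rcases le_total k k' with h | h
      · refine ⟨k, hk, hf, ?_⟩
        filter_upwards [he, he'] with i a b
        by_cases t : T i
        · exact a t
        · exact h.trans (b t)
      · refine ⟨k', hk', hf', ?_⟩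
        filter_upwards [he, he'] with i a b
        by_cases t : T i
        · exact h.trans (a t)
        · exact b t
    · refine ⟨k, hk, hf, ?_⟩
      have := Nat.frequently_atTop_iff_infinite.not.2 i₂
      rw [not_frequently] at this
      filter_upwards [he, this] with i a b
      exact a (not_not.1 b)
  · have hT := Nat.frequently_atTop_iff_infinite.not.2 i₁
    rw [not_frequently] at hT
    have i₂ : {n | ¬ T n}.Infinite := Nat.frequently_atTop_iff_infinite.1 hT.frequently
    obtain ⟨k, hk, hf, he⟩ := (h₂ i₂).of_nth i₂
    refine ⟨k, hk, hf, ?_⟩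
    filter_upwards [he, hT] with i a b
    exact a b

/-- `GoodInf` is closed under shuffling. -/
theorem GoodInf.shuffle {T : ℕ → Prop}
    (h₁ : {n | T n}.Infinite → GoodInf r p fun k => c (Nat.nth T k))
    (h₂ : {n | ¬ T n}.Infinite → GoodInf r p fun k => c (Nat.nth (fun n => ¬ T n) k)) :
    GoodInf r p c := by
  classical
  refine ⟨fun ε hε => ?_, EvenLeast.shuffle (fun i => (h₁ i).2) fun i => (h₂ i).2⟩
  obtain ⟨K₁, hK₁⟩ := exists_lower_bound_filter h₁ (ε / 2) (half_pos hε)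
  obtain ⟨K₂, hK₂⟩ := exists_lower_bound_filter h₂ (ε / 2) (half_pos hε)
  refine ⟨K₁ + K₂, fun n => ?_⟩
  have := Finset.sum_filter_add_sum_filter_not (Finset.range n) T fun i => r (c i)
  linarith [hK₁ n, hK₂ n]

end Sequences

/-! ### Repeating closed segments of a word -/

section Replay

/-- Before pass `i` there are `i` passes of length at least one. If pass `i` uses segment `φ i`, its
length is thus negligible against the elapsed time, however fast `l` grows. -/
theorem exists_slow_index (l : ℕ → ℕ) :
    ∃ φ : ℕ → ℕ, Tendsto φ atTop atTop ∧ ∀ i, φ i * l (φ i) ≤ i := by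
  refine ⟨fun i => Nat.findGreatest (fun k => k * l k ≤ i) i, ?_, fun i => ?_⟩
  · refine tendsto_atTop.2 fun k => eventually_atTop.2 ⟨max k (k * l k), fun i hi => ?_⟩
    exact Nat.le_findGreatest (by omega) (by omega)
  · exact Nat.findGreatest_spec (P := fun k => k * l k ≤ i) (Nat.zero_le i) (by simp)

/-- Positions visited when the `i`-th pass through a word stops at position `e i` and resumes at
position `N`. The second component counts the passes. -/
def replay (N : ℕ) (e : ℕ → ℕ) : ℕ → ℕ × ℕ
  | 0 => (0, 0)
  | n + 1 => if (replay N e n).1 + 1 = e (replay N e n).2 then (N, (replay N e n).2 + 1)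
      else ((replay N e n).1 + 1, (replay N e n).2)

variable {N : ℕ} {e : ℕ → ℕ}

theorem replay_fst_lt (he : ∀ i, N < e i) (n : ℕ) : (replay N e n).1 < e (replay N e n).2 := by
  induction n with
  | zero => exact (Nat.zero_le N).trans_lt (he 0)
  | succ n ih =>
    rw [replay]
    split_ifs with h
    · exact he _
    · exact lt_of_le_of_ne ih h

theorem replay_add (n s : ℕ) (h : (replay N e n).1 + s < e (replay N e n).2) :
    replay N e (n + s) = ((replay N e n).1 + s, (replay N e n).2) := by
  induction s with
  | zero => rfl
  | succ s ih =>
    rw [← add_assoc, replay, ih (by omega), if_neg]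
    · rfl
    · simp only; omega

theorem replay_sum (f : ℕ → ℝ) (n : ℕ) :
    ∑ i ∈ Finset.range n, f (replay N e i).1 = ∑ i ∈ Finset.range (replay N e n).1, f i +
      ∑ j ∈ Finset.range (replay N e n).2,
        (∑ i ∈ Finset.range (e j), f i - ∑ i ∈ Finset.range N, f i) := by
  induction n with
  | zero => simp [replay]
  | succ n ih =>
    rw [Finset.sum_range_succ, ih, replay]
    split_ifs with h
    · simp only [Finset.sum_range_succ _ (replay N e n).2]
      rw [← h, Finset.sum_range_succ]
      ring
    · rw [Finset.sum_range_succ _ (replay N e n).1]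
      ring

/-- After any time some segment is traversed in full, so what every segment contains recurs forever.
-/
theorem exists_replay_eq (he : ∀ i, N < e i) (n : ℕ) :
    ∃ m ≥ n, ∃ i, ∀ t, N ≤ t → t < e i → replay N e (m + (t - N)) = (t, i) := by
  have h := replay_fst_lt he n
  have h1 : replay N e (n + (e (replay N e n).2 - (replay N e n).1 - 1) + 1) =
      (N, (replay N e n).2 + 1) := by
    rw [replay, replay_add _ _ (by omega), if_pos]
    simp only; omega
  refine ⟨_, (by omega : n ≤ n + (e (replay N e n).2 - (replay N e n).1 - 1) + 1),
    (replay N e n).2 + 1, fun t ht hte => ?_⟩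
  rw [replay_add _ _ (by rw [h1]; simp only; omega), h1]
  simp only [Prod.mk.injEq, and_true]
  omega

theorem eventually_le_replay_fst (he : ∀ i, N < e i) :
    ∀ᶠ n in atTop, N ≤ (replay N e n).1 := by
  obtain ⟨m, -, i, hm⟩ := exists_replay_eq he 0
  refine eventually_atTop.2 ⟨m, fun n hn => ?_⟩
  induction n, hn using Nat.le_induction with
  | base => have := hm N le_rfl (he i); simp at this; simp [this]
  | succ n _ ih =>
    rw [replay]
    split_ifs
    · rfl
    · simp only; omega

end Replay

/-! ### From limit superior to limit inferior along paths -/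

section Paths

variable {V L : Type*}

/-- A single vertex has to serve all `ε`. If each vertex `w` failed for some `ε w`, the least of
these finitely many numbers would contradict `h`. -/
theorem exists_recurrent_vertex [Finite V] {r : L → ℝ} {v : ℕ → V} {c : ℕ → L}
    (h : ∀ ε : ℝ, 0 < ε → ∃ᶠ n : ℕ in atTop, -ε * n ≤ ∑ i ∈ Finset.range n, r (c i)) :
    ∃ w, ∀ ε : ℝ, 0 < ε →
      ∃ᶠ n : ℕ in atTop, v n = w ∧ -ε * n ≤ ∑ i ∈ Finset.range n, r (c i) := by
  by_contra! H
  choose ε hε H using H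
  have : Nonempty V := ⟨v 0⟩
  obtain ⟨w, hw⟩ := Finite.exists_min ε
  refine h (ε w) (hε w) ?_
  filter_upwards [eventually_all.2 H] with n hn hc
  refine (hn (v n) rfl).not_ge (le_trans ?_ hc)
  have := mul_le_mul_of_nonneg_right (hw (v n)) (Nat.cast_nonneg (α := ℝ) n)
  linarith

/-- A path that satisfies `GoodSup` has a closed segment at a fixed position with average
arbitrarily close to non-negative. -/
theorem exists_segments [Finite V] {r : L → ℝ} {p : L → ℕ} {v : ℕ → V} {c : ℕ → L}
    (h : GoodSup r p c) :
    ∃ (N : ℕ) (k : ℕ), Even k ∧ (∀ i ≥ N, k ≤ p (c i)) ∧ ∀ j : ℕ, ∃ e, N < e ∧ v e = v N ∧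
      -(1 / ((j : ℝ) + 1)) * ((e - N : ℕ) : ℝ) ≤
        ∑ i ∈ Finset.range e, r (c i) - ∑ i ∈ Finset.range N, r (c i) ∧
      ∃ i, N ≤ i ∧ i < e ∧ p (c i) = k := by
  obtain ⟨w, hw⟩ := exists_recurrent_vertex (v := v) h.1
  obtain ⟨k, hk, hf, he⟩ := h.2
  obtain ⟨N₁, hN₁⟩ := eventually_atTop.1 he
  obtain ⟨N, hN, hvN, -⟩ := frequently_atTop.1 (hw 1 one_pos) N₁
  refine ⟨N, k, hk, fun i hi => hN₁ i (le_trans hN hi), fun j => ?_⟩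
  obtain ⟨i, hi, hik⟩ := frequently_atTop.1 hf N
  set S := ∑ i ∈ Finset.range N, r (c i)
  -- Half the allowed loss; the other half pays for the prefix up to `N` once `e ≥ 2 * N + S / ε`.
  set ε : ℝ := 1 / (2 * ((j : ℝ) + 1)) with hεd
  have hε : 0 < ε := by positivity
  obtain ⟨B, hB⟩ := exists_nat_ge (2 * N + S / ε)
  obtain ⟨e, hel, hev, hes⟩ := frequently_atTop.1 (hw ε hε) (max (i + 1) B)
  refine ⟨e, by omega, hev.trans hvN.symm, ?_, i, hi, by omega, hik⟩
  have h1 : (1 / ((j : ℝ) + 1)) = 2 * ε := by rw [hεd]; field_simp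
  have h2 : (B : ℝ) ≤ e := by exact_mod_cast (le_max_right _ _).trans hel
  have h3 : ε * (2 * N + S / ε) ≤ ε * e := mul_le_mul_of_nonneg_left (hB.trans h2) hε.le
  have h4 : ε * (S / ε) = S := by field_simp
  rw [h1, Nat.cast_sub (by omega)]
  rw [mul_add, h4] at h3
  linarith

/-- Apart from finitely many, completed passes lose at most `ε / 2` per step. The unfinished pass
loses at most `R` per step, which the slow growth of `φ` bounds by `ε / 2` times the number of
passes, up to a constant. -/
theorem replay_lower_bound {f : ℕ → ℝ} {R : ℝ} (hR : ∀ i, |f i| ≤ R) {N : ℕ} {e φ : ℕ → ℕ}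
    (he : ∀ j, N < e j)
    (hgain : ∀ j : ℕ, -(1 / ((j : ℝ) + 1)) * ((e j - N : ℕ) : ℝ) ≤
      ∑ i ∈ Finset.range (e j), f i - ∑ i ∈ Finset.range N, f i)
    (hφ : Tendsto φ atTop atTop) (hφe : ∀ i, φ i * (e (φ i) - N) ≤ i) (ε : ℝ) (hε : 0 < ε) :
    ∃ K : ℝ, ∀ n : ℕ, -ε * n - K ≤
      ∑ i ∈ Finset.range n, f (replay N (fun i => e (φ i)) i).1 := by
  have hR0 : 0 ≤ R := (abs_nonneg _).trans (hR 0)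
  set l : ℕ → ℝ := fun j => ((e (φ j) - N : ℕ) : ℝ) with hl
  have hl1 : ∀ j, 1 ≤ l j := fun j => by
    have := he (φ j)
    simp only [hl]
    exact_mod_cast (by omega : 1 ≤ e (φ j) - N)
  obtain ⟨B, hB⟩ := exists_nat_ge (max (2 / ε) (2 * R / ε))
  obtain ⟨I, hI⟩ := eventually_atTop.1 (hφ.eventually_ge_atTop B)
  have hB1 : ∀ i ≥ I, 1 ≤ ε / 2 * φ i := fun i hi => by
    have h : 2 / ε ≤ φ i := (le_max_left _ _).trans (hB.trans (by exact_mod_cast hI i hi))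
    rw [div_le_iff₀ hε] at h
    linarith
  have hB2 : ∀ i ≥ I, R ≤ ε / 2 * φ i := fun i hi => by
    have h : 2 * R / ε ≤ φ i := (le_max_right _ _).trans (hB.trans (by exact_mod_cast hI i hi))
    rw [div_le_iff₀ hε] at h
    linarith
  set K := ∑ j ∈ Finset.range I, l j with hK
  have hK0 : 0 ≤ K := Finset.sum_nonneg fun j _ => by linarith [hl1 j]
  have hlast : ∀ i : ℕ, R * l i ≤ ε / 2 * i + R * K := fun i => by
    by_cases hi : I ≤ i
    · have h1 : (φ i : ℝ) * l i ≤ i := by simp only [hl]; exact_mod_cast hφe i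
      have h2 := mul_le_mul_of_nonneg_right (hB2 i hi) (by linarith [hl1 i] : 0 ≤ l i)
      have h3 := mul_le_mul_of_nonneg_left h1 (half_pos hε).le
      have := mul_nonneg hR0 hK0
      linarith
    · have h1 : l i ≤ K := Finset.single_le_sum (f := l) (fun j _ => by linarith [hl1 j])
        (Finset.mem_range.2 (by omega))
      have h2 := mul_le_mul_of_nonneg_left h1 hR0
      have : 0 ≤ ε / 2 * i := by positivity
      linarith
  have hsum : ∀ i : ℕ, -(ε / 2) * ∑ j ∈ Finset.range i, l j - K ≤ ∑ j ∈ Finset.range i,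
      (∑ i ∈ Finset.range (e (φ j)), f i - ∑ i ∈ Finset.range N, f i) := fun i => by
    have h1 : ∀ j, -(ε / 2) * l j - (if j < I then l j else 0) ≤
        ∑ i ∈ Finset.range (e (φ j)), f i - ∑ i ∈ Finset.range N, f i := fun j => by
      refine le_trans ?_ (hgain (φ j))
      have hj := hl1 j
      have hle : (1 / ((φ j : ℝ) + 1)) ≤ ε / 2 + if j < I then 1 else 0 := by
        split_ifs with h
        · have : (1 / ((φ j : ℝ) + 1)) ≤ 1 := by
            rw [div_le_one (by positivity)]
            linarith [Nat.cast_nonneg (α := ℝ) (φ j)]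
          linarith
        · rw [div_le_iff₀ (by positivity)]
          have := hB1 j (by omega)
          nlinarith
      have h2 := mul_le_mul_of_nonneg_right hle (by linarith : 0 ≤ l j)
      have h3 : (if j < I then (1 : ℝ) else 0) * l j = if j < I then l j else 0 := by
        split_ifs <;> simp
      rw [add_mul, h3] at h2
      change _ ≤ -(1 / ((φ j : ℝ) + 1)) * l j
      linarith
    have h2 := Finset.sum_le_sum fun j (_ : j ∈ Finset.range i) => h1 j
    rw [Finset.sum_sub_distrib, ← Finset.mul_sum, ← Finset.sum_filter] at h2
    have h3 : ∑ j ∈ Finset.range i with j < I, l j ≤ K :=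
      Finset.sum_le_sum_of_subset_of_nonneg
        (fun j hj => Finset.mem_range.2 (Finset.mem_filter.1 hj).2)
        fun j _ _ => by linarith [hl1 j]
    linarith
  refine ⟨R * N + R * K + K, fun n => ?_⟩
  rw [replay_sum]
  set t := (replay N (fun i => e (φ i)) n).1 with ht
  set i := (replay N (fun i => e (φ i)) n).2 with hi
  have hn : (n : ℝ) = t + ∑ j ∈ Finset.range i, l j := by
    -- Summing the constant `1` measures the elapsed time.
    have := replay_sum (N := N) (e := fun i => e (φ i)) (fun _ => (1 : ℝ)) n
    simp only [Finset.sum_const, Finset.card_range, nsmul_eq_mul, mul_one] at this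
    rw [this]
    congr 1
    exact Finset.sum_congr rfl fun j _ => by simp only [hl]; rw [Nat.cast_sub (he _).le]
  have hin : (i : ℝ) ≤ ∑ j ∈ Finset.range i, l j := by
    have := Finset.sum_le_sum fun j (_ : j ∈ Finset.range i) => hl1 j
    simpa using this
  have htl : (t : ℝ) ≤ N + l i := by
    have h1 := replay_fst_lt (N := N) (e := fun i => e (φ i)) (fun i => he _) n
    have h2 := he (φ i)
    simp only [hl]
    exact_mod_cast (by simp only [← ht, ← hi] at h1; omega : t ≤ N + (e (φ i) - N))
  have hS : -(R * t) ≤ ∑ i ∈ Finset.range t, f i := by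
    have := Finset.sum_le_sum fun j (_ : j ∈ Finset.range t) => (abs_le.1 (hR j)).1
    simp only [Finset.sum_const, Finset.card_range, nsmul_eq_mul] at this
    linarith
  have h1 := hsum i
  have h2 := hlast i
  have h3 := mul_le_mul_of_nonneg_left htl hR0
  have h4 := mul_le_mul_of_nonneg_left hin (half_pos hε).le
  have h5 : 0 ≤ ε * t := by positivity
  rw [hn]
  linarith

/-- In a finite graph a path that satisfies `GoodSup` can be replaced by one that satisfies
`GoodInf`. -/
theorem exists_goodInf_path [Finite V] [Finite L] {r : L → ℝ} {p : L → ℕ}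
    {mv : V → Set (L × V)} {v : ℕ → V} {c : ℕ → L} (hp : ∀ n, (c n, v (n + 1)) ∈ mv (v n))
    (h : GoodSup r p c) :
    ∃ (v' : ℕ → V) (c' : ℕ → L), v' 0 = v 0 ∧ (∀ n, (c' n, v' (n + 1)) ∈ mv (v' n)) ∧
      GoodInf r p c' := by
  obtain ⟨N, k, hk, hle, hseg⟩ := exists_segments (v := v) h
  choose e he hev hgain hpk using hseg
  obtain ⟨φ, hφ, hφe⟩ := exists_slow_index fun j => e j - N
  have : Nonempty L := ⟨c 0⟩
  obtain ⟨l₀, hl₀⟩ := Finite.exists_max fun l => |r l|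
  set s := replay N (fun i => e (φ i)) with hs
  have he' : ∀ i, N < e (φ i) := fun i => he _
  refine ⟨fun n => v (s n).1, fun n => c (s n).1, rfl, fun n => ?_,
    fun ε hε => replay_lower_bound (f := fun i => r (c i)) (fun i => hl₀ (c i)) he hgain hφ hφe ε hε,
    k, hk, ?_, ?_⟩
  · have : v (s (n + 1)).1 = v ((s n).1 + 1) := by
      simp only [hs, replay]
      split_ifs with h
      · rw [h, hev]
      · rfl
    simp only [this]
    exact hp _
  · refine frequently_atTop.2 fun n => ?_
    obtain ⟨m, hm, i, hi⟩ := exists_replay_eq he' n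
    obtain ⟨t, ht, hte, htk⟩ := hpk (φ i)
    exact ⟨m + (t - N), by omega, by simp only [hs, hi t ht hte, htk]⟩
  · filter_upwards [eventually_le_replay_fst he'] with n hn
    exact hle _ hn

end Paths

/-! ### Determinacy of finite graph games -/

/-- A Player 1 strategy with memory `M` in a graph game whose moves are pairs of a label and a
target vertex. -/
structure MemStrat (V L : Type*) (M : Type) where
  /-- the chosen move -/
  act : M → V → L × V
  /-- the memory update -/
  upd : M → V → L × V → M

section Arena

variable {V L : Type*} {M : Type}

/-- From vertex `q` and memory `m`, all plays compatible with `σ` satisfy `GoodInf`. -/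
def MemStrat.Wins (σ : MemStrat V L M) (r : L → ℝ) (p : L → ℕ) (own : Set V)
    (mv : V → Set (L × V)) (q : V) (m : M) : Prop :=
  ∀ (v : ℕ → V) (c : ℕ → L) (μ : ℕ → M), v 0 = q → μ 0 = m →
    (∀ n, (c n, v (n + 1)) ∈ mv (v n)) →
    (∀ n, v n ∈ own → (c n, v (n + 1)) = σ.act (μ n) (v n)) →
    (∀ n, μ (n + 1) = σ.upd (μ n) (v n) (c n, v (n + 1))) → GoodInf r p c

/-- Player 1 can ensure `GoodInf` from `q`. -/
def Wins₁ (r : L → ℝ) (p : L → ℕ) (own : Set V) (mv : V → Set (L × V)) (q : V) : Prop :=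
  ∃ (M : Type) (σ : MemStrat V L M) (m : M),
    (∀ m, ∀ v ∈ own, σ.act m v ∈ mv v) ∧ σ.Wins r p own mv q m

/-- Player 2 can positionally prevent `GoodSup` from `q`. -/
def Wins₂ (r : L → ℝ) (p : L → ℕ) (own : Set V) (mv : V → Set (L × V)) (q : V) : Prop :=
  ∃ τ : V → L × V, (∀ v, τ v ∈ mv v) ∧ ∀ (v : ℕ → V) (c : ℕ → L), v 0 = q →
    (∀ n, (c n, v (n + 1)) ∈ mv (v n)) → (∀ n, v n ∉ own → (c n, v (n + 1)) = τ (v n)) →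
    ¬ GoodSup r p c

variable {r : L → ℝ} {p : L → ℕ} {own : Set V} {mv : V → Set (L × V)} {q : V}

theorem MemStrat.Wins.step {σ : MemStrat V L M} {m : M} (h : σ.Wins r p own mv q m) {e : L × V}
    (he : e ∈ mv q) (ho : q ∈ own → e = σ.act m q) : σ.Wins r p own mv e.2 (σ.upd m q e) := by
  intro v c μ hv hμ h1 h2 h3
  refine (h (fun n => n.casesOn q v) (fun n => n.casesOn e.1 c) (fun n => n.casesOn m μ)
    rfl rfl ?_ ?_ ?_).tail
  · rintro (_ | n)
    · simpa [hv] using he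
    · exact h1 n
  · rintro (_ | n) hn
    · simpa [hv] using ho hn
    · exact h2 n hn
  · rintro (_ | n)
    · simpa [hv] using hμ
    · exact h3 n

theorem Wins₁.not_wins₂ {σ : MemStrat V L M} {m : M} (hσ : ∀ m, ∀ v ∈ own, σ.act m v ∈ mv v)
    (h : σ.Wins r p own mv q m) : ¬ Wins₂ r p own mv q := by
  classical
  rintro ⟨τ, hτ, hw⟩
  let mvt : V × M → L × V := fun x => if x.1 ∈ own then σ.act x.2 x.1 else τ x.1
  let s : ℕ → V × M := fun n => n.rec (q, m) fun _ x => ((mvt x).2, σ.upd x.2 x.1 (mvt x))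
  have hm : ∀ x, mvt x ∈ mv x.1 := fun x => by
    simp only [mvt]
    split_ifs with hx
    · exact hσ _ _ hx
    · exact hτ _
  refine hw (fun n => (s n).1) (fun n => (mvt (s n)).1) rfl (fun n => hm (s n)) ?_
    (h (fun n => (s n).1) (fun n => (mvt (s n)).1) (fun n => (s n).2) rfl rfl
      (fun n => hm (s n)) ?_ fun n => rfl).goodSup
  · intro n hn
    change mvt (s n) = _
    simp only [mvt]
    rw [if_neg hn]
  · intro n hn
    change mvt (s n) = _
    simp only [mvt]
    rw [if_pos hn]

theorem eq_of_constant_off {X : Type*} {z : ℕ → X} {T : ℕ → Prop} (hz : ∀ n, ¬ T n → z (n + 1) = z n)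
    {a b : ℕ} (hab : a ≤ b) (h : ∀ i, a ≤ i → i < b → ¬ T i) : z b = z a := by
  induction b, hab using Nat.le_induction with
  | base => rfl
  | succ b hb ih =>
    rw [hz b (h b hb (by omega))]
    exact ih fun i hi hib => h i hi (by omega)

/-- A component that changes only at times in `T` can be read along the enumeration of `T` without
losing a step. -/
theorem nth_constant_off {X : Type*} {z : ℕ → X} {T : ℕ → Prop} (hT : {n | T n}.Infinite)
    (hz : ∀ n, ¬ T n → z (n + 1) = z n) :
    z (Nat.nth T 0) = z 0 ∧ ∀ k, z (Nat.nth T (k + 1)) = z (Nat.nth T k + 1) := by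
  refine ⟨eq_of_constant_off hz (Nat.zero_le _) fun i _ hi hTi => ?_, fun k =>
    eq_of_constant_off hz (Nat.nth_strictMono hT (Nat.lt_succ_self k)) fun i hi hi' hTi => ?_⟩
  · rw [Nat.nth_zero] at hi
    exact (Nat.sInf_le hTi).not_gt hi
  · exact absurd hi (not_le.2 (Nat.lt_succ_of_le (Nat.le_nth_of_lt_nth_succ hi' hTi)))

/-- The moves made at the times in `T` form a play compatible with a winning strategy. -/
theorem MemStrat.Wins.goodInf_nth {σ : MemStrat V L M} {m : M} (h : σ.Wins r p own mv q m)
    {v pos : ℕ → V} {c : ℕ → L} {μ : ℕ → M} {T : ℕ → Prop} (hpos : pos 0 = q) (hμ : μ 0 = m)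
    (hin : ∀ n, T n → pos n = v n ∧ (c n, v (n + 1)) ∈ mv (v n) ∧
      (v n ∈ own → (c n, v (n + 1)) = σ.act (μ n) (v n)) ∧ pos (n + 1) = v (n + 1) ∧
      μ (n + 1) = σ.upd (μ n) (v n) (c n, v (n + 1)))
    (hout : ∀ n, ¬ T n → pos (n + 1) = pos n ∧ μ (n + 1) = μ n) (hT : {n | T n}.Infinite) :
    GoodInf r p fun k => c (Nat.nth T k) := by
  have hin' := fun k => hin _ (Nat.nth_mem_of_infinite hT k)
  obtain ⟨p0, ps⟩ := nth_constant_off hT fun n hn => (hout n hn).1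
  obtain ⟨m0, ms⟩ := nth_constant_off hT fun n hn => (hout n hn).2
  have key : ∀ k, pos (Nat.nth T (k + 1)) = v (Nat.nth T k + 1) := fun k => by
    rw [ps k, (hin' k).2.2.2.1]
  refine h (fun k => pos (Nat.nth T k)) _ (fun k => μ (Nat.nth T k)) (p0.trans hpos)
    (m0.trans hμ) ?_ ?_ ?_
  · intro k
    simp only [key]
    rw [(hin' k).1]
    exact (hin' k).2.1
  · intro k hk
    simp only [key]
    simp only [(hin' k).1] at hk ⊢
    exact (hin' k).2.2.1 hk
  · intro k
    simp only [key, ms k]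
    rw [(hin' k).1]
    exact (hin' k).2.2.2.2

/-- Winning strategies for two subgames that share out the moves of Player 2 at `x` combine. -/
theorem Wins₁.combine {mv₁ mv₂ : V → Set (L × V)} {x : V} (hx : x ∉ own)
    (h₁ : ∀ v ≠ x, mv₁ v = mv v) (h₂ : ∀ v ≠ x, mv₂ v = mv v) (h₁₂ : mv x ⊆ mv₁ x ∪ mv₂ x)
    (hw₁ : Wins₁ r p own mv₁ q) (hw₂ : Wins₁ r p own mv₂ x) : Wins₁ r p own mv q := by
  classical
  obtain ⟨M₁, σ₁, m₁, hσ₁, hw₁⟩ := hw₁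
  obtain ⟨M₂, σ₂, m₂, hσ₂, hw₂⟩ := hw₂
  -- The flag tells which strategy is active: at `x` the move of Player 2 decides, elsewhere the
  -- flag is kept.
  let fl : Bool → V → L × V → Bool := fun b v e => if v = x then decide (e ∈ mv₁ x) else b
  refine ⟨M₁ × M₂ × Bool,
    ⟨fun m v => if m.2.2 then σ₁.act m.1 v else σ₂.act m.2.1 v, fun m v e =>
      if fl m.2.2 v e then (σ₁.upd m.1 v e, m.2.1, true) else (m.1, σ₂.upd m.2.1 v e, false)⟩,
    (m₁, m₂, true), ?_, ?_⟩
  · intro m v hv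
    have hvx : v ≠ x := fun h => hx (h ▸ hv)
    simp only
    split_ifs
    · exact h₁ v hvx ▸ hσ₁ _ _ hv
    · exact h₂ v hvx ▸ hσ₂ _ _ hv
  · intro v c μ hv hμ hplay hcons hupd
    let T : ℕ → Prop := fun n => fl (μ n).2.2 (v n) (c n, v (n + 1)) = true
    have hT : ∀ n, T n → μ (n + 1) =
        (σ₁.upd (μ n).1 (v n) (c n, v (n + 1)), (μ n).2.1, true) := fun n hn => by
      rw [hupd n]; exact if_pos hn
    have hF : ∀ n, ¬ T n → μ (n + 1) =
        ((μ n).1, σ₂.upd (μ n).2.1 (v n) (c n, v (n + 1)), false) := fun n hn => by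
      rw [hupd n]; exact if_neg hn
    have hTx : ∀ n, v n ≠ x → (T n ↔ (μ n).2.2 = true) := fun n hn => by simp [T, fl, hn]
    have hxT : ∀ n, v n = x → (T n ↔ (c n, v (n + 1)) ∈ mv₁ x) := fun n hn => by
      simp [T, fl, hn]
    refine GoodInf.shuffle (T := T)
      -- A suspended strategy waits at `x`, because control changes only there; the second one
      -- starts out waiting.
      (hw₁.goodInf_nth (pos := fun n => if (μ n).2.2 then v n else x) (v := v)
        (μ := fun n => (μ n).1) ?_ ?_ ?_ ?_)
      (hw₂.goodInf_nth (pos := fun n => if (μ n).2.2 then x else v n) (v := v)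
        (μ := fun n => (μ n).2.1) ?_ ?_ ?_ ?_)
    · simp [hμ, hv]
    · simp [hμ]
    · intro n hn
      have hm := hT n hn
      by_cases hvx : v n = x
      · refine ⟨by simp [hvx], hvx ▸ (hxT n hvx).1 hn, fun ho => absurd (hvx ▸ ho) hx, ?_, ?_⟩ <;>
          simp [hm]
      · have hb := (hTx n hvx).1 hn
        refine ⟨by simp [hb], h₁ _ hvx ▸ hplay n, fun ho => ?_, ?_, ?_⟩
        · simpa [hb] using hcons n ho
        · simp [hm]
        · simp [hm]
    · intro n hn
      have hm := hF n hn
      by_cases hvx : v n = x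
      · simp [hm, hvx]
      · have hb := (hTx n hvx).not.1 hn
        simp [hm, hb]
    · simp [hμ]
    · simp [hμ]
    · intro n hn
      have hm := hF n hn
      by_cases hvx : v n = x
      · refine ⟨by simp [hvx], ?_, fun ho => absurd (hvx ▸ ho) hx, ?_, ?_⟩
        · have := h₁₂ (hvx ▸ hplay n)
          exact hvx ▸ this.resolve_left ((hxT n hvx).not.1 hn)
        · simp [hm]
        · simp [hm]
      · have hb := (hTx n hvx).not.1 hn
        refine ⟨by simp [hb], h₂ _ hvx ▸ hplay n, fun ho => ?_, ?_, ?_⟩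
        · simpa [hb] using hcons n ho
        · simp [hm]
        · simp [hm]
    · intro n hn
      have hm := hT n (not_not.1 hn)
      by_cases hvx : v n = x
      · simp [hm, hvx]
      · have hb := (hTx n hvx).1 (not_not.1 hn)
        simp [hm, hb]

/-- A strategy winning in a subgame in which Player 2 wins from `x` avoids `x`. -/
theorem Wins₁.of_wins₂ {mv₂ : V → Set (L × V)} {x : V} (hx : x ∉ own)
    (h₂ : ∀ v ≠ x, mv₂ v = mv v) (hw : Wins₁ r p own mv₂ q) (hw₂ : Wins₂ r p own mv₂ x) :
    Wins₁ r p own mv q := by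
  obtain ⟨M, σ, m, hσ, hw⟩ := hw
  refine ⟨M, σ, m, fun m v hv => h₂ v (fun h => hx (h ▸ hv)) ▸ hσ m v hv, ?_⟩
  intro v c μ hv hμ hplay hcons hupd
  have hne : ∀ n, σ.Wins r p own mv₂ (v n) (μ n) → v n ≠ x := fun n h hvx =>
    Wins₁.not_wins₂ hσ h (hvx ▸ hw₂)
  have hwin : ∀ n, σ.Wins r p own mv₂ (v n) (μ n) := fun n => by
    induction n with
    | zero => rwa [hv, hμ]
    | succ n ih =>
      rw [hupd n]
      exact ih.step (e := (c n, v (n + 1))) (h₂ _ (hne n ih) ▸ hplay n) (hcons n)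
  exact hw v c μ hv hμ (fun n => h₂ _ (hne n (hwin n)) ▸ hplay n) hcons hupd

theorem Wins₂.mono {mv' : V → Set (L × V)} (h : ∀ v, mv' v ⊆ mv v)
    (ho : ∀ v ∈ own, mv' v = mv v) (hw : Wins₂ r p own mv' q) : Wins₂ r p own mv q := by
  obtain ⟨τ, hτ, hw⟩ := hw
  refine ⟨τ, fun v => h v (hτ v), fun v c hv hplay hcons => hw v c hv (fun n => ?_) hcons⟩
  by_cases hn : v n ∈ own
  · exact ho _ hn ▸ hplay n
  · exact hcons n hn ▸ hτ _

/-- Only Player 1 has choices, so a strategy is a path: the memory is a clock, and Player 1 follows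
a fixed `GoodInf` path if a `GoodSup` path exists. -/
theorem wins_of_subsingleton [Finite V] [Finite L] (hne : ∀ v, (mv v).Nonempty)
    (hs : ∀ v ∉ own, (mv v).Subsingleton) (q : V) :
    Wins₁ r p own mv q ∨ Wins₂ r p own mv q := by
  classical
  choose d hd using hne
  by_cases h : ∃ (v : ℕ → V) (c : ℕ → L), v 0 = q ∧ (∀ n, (c n, v (n + 1)) ∈ mv (v n)) ∧
    GoodSup r p c
  · left
    obtain ⟨v, c, hv, hp, hc⟩ := h
    obtain ⟨w, b, hw, hwp, hb⟩ := exists_goodInf_path hp hc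
    refine ⟨ℕ, ⟨fun n x => if x = w n then (b n, w (n + 1)) else d x, fun n _ _ => n + 1⟩, 0,
      fun n x _ => ?_, ?_⟩
    · simp only
      split_ifs with hx
      · exact hx ▸ hwp n
      · exact hd x
    · intro v' c' μ hv' hμ hplay hcons hupd
      have hμ' : ∀ n, μ n = n := fun n => by
        induction n with
        | zero => exact hμ
        | succ n ih => rw [hupd, ih]
      have hstep : ∀ n, v' n = w n → (c' n, v' (n + 1)) = (b n, w (n + 1)) := fun n hn => by
        by_cases ho : v' n ∈ own
        · rw [hcons n ho]
          simp [hn, hμ']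
        · exact hs _ ho (hplay n) (hn ▸ hwp n)
      have hvw : ∀ n, v' n = w n := fun n => by
        induction n with
        | zero => rw [hv', hw, hv]
        | succ n ih => exact congrArg Prod.snd (hstep n ih)
      have : c' = b := funext fun n => congrArg Prod.fst (hstep n (hvw n))
      rwa [this]
  · exact Or.inr ⟨d, hd, fun v c hv hp _ hc => h ⟨v, c, hv, hp, hc⟩⟩

/-- Half-positional determinacy of finite graph games with condition `GoodInf` for Player 1 and
the negation of `GoodSup` for Player 2. -/
theorem wins₁_or_wins₂ [Finite V] [Finite L] (r : L → ℝ) (p : L → ℕ) (own : Set V)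
    (mv : V → Set (L × V)) (hne : ∀ v, (mv v).Nonempty) (q : V) :
    Wins₁ r p own mv q ∨ Wins₂ r p own mv q := by
  classical
  induction hn : {y : V × (L × V) | y.2 ∈ mv y.1}.ncard using Nat.strong_induction_on
    generalizing mv q with
  | _ N ih =>
  by_cases hs : ∀ v ∉ own, (mv v).Subsingleton
  · exact wins_of_subsingleton hne hs q
  push Not at hs
  obtain ⟨x, hx, hs⟩ := hs
  obtain ⟨e₀, he₀, e₁, he₁, hne₁⟩ := hs
  have key : ∀ D : Set (L × V), D ⊂ mv x → D.Nonempty → ∀ q,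
      Wins₁ r p own (Function.update mv x D) q ∨ Wins₂ r p own (Function.update mv x D) q := by
    intro D hD hDn q
    refine ih _ ?_ _ (fun v => ?_) q rfl
    · rw [← hn]
      refine Set.ncard_lt_ncard ⟨?_, fun hsub => ?_⟩
      · rintro ⟨v, e⟩ he
        by_cases hv : v = x
        · subst hv
          exact hD.1 (by simpa using he)
        · simpa [hv] using he
      · refine hD.2 fun e he => ?_
        simpa using hsub (show (x, e) ∈ {y : V × (L × V) | y.2 ∈ mv y.1} from he)
    · by_cases hv : v = x
      · subst hv; simpa using hDn
      · simpa [hv] using hne v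
  have hoff : ∀ D : Set (L × V), ∀ v ≠ x, Function.update mv x D v = mv v := fun D v hv => by
    simp [hv]
  have hmono : ∀ D : Set (L × V), D ⊆ mv x → Wins₂ r p own (Function.update mv x D) q →
      Wins₂ r p own mv q := fun D hD => Wins₂.mono
    (fun v => by
      by_cases hv : v = x
      · subst hv; simpa using hD
      · simp [hv])
    fun v hv => hoff D v fun h => hx (h ▸ hv)
  have hD₁ : {e₀} ⊂ mv x := ⟨by simpa using he₀, fun h => hne₁ (h he₁).symm⟩
  have hD₂ : mv x \ {e₀} ⊂ mv x := ⟨Set.sdiff_subset, fun h => (h he₀).2 rfl⟩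
  have hn₂ : (mv x \ {e₀}).Nonempty := ⟨e₁, he₁, fun h => hne₁ h.symm⟩
  rcases key _ hD₁ (Set.singleton_nonempty _) q with hq₁ | hq₁
  swap
  · exact Or.inr (hmono _ hD₁.1 hq₁)
  rcases key _ hD₂ hn₂ q with hq₂ | hq₂
  swap
  · exact Or.inr (hmono _ hD₂.1 hq₂)
  left
  -- The first game is needed only from `q`; the second strategy is started when Player 2 first
  -- leaves `x` by a move other than `e₀`.
  rcases key _ hD₂ hn₂ x with hx₂ | hx₂
  · refine Wins₁.combine hx (hoff _) (hoff _) (fun e he => ?_) hq₁ hx₂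
    by_cases h : e = e₀
    · simp [h]
    · simp [h, he]
  · exact Wins₁.of_wins₂ hx (hoff _) hq₂ hx₂

end Arena

/-! ### Comparison with the winning condition -/

section WinningCondition

variable {C : Type*} {S : Set C} {r : C → ℝ} {p : C → ℕ} {u : ℕ → C}

theorem parityCondition_of_evenLeast (h : EvenLeast p u) : p ∘ u ∈ parityCondition := by
  obtain ⟨k, hk, hf, he⟩ := h
  refine ⟨k, ⟨hf, fun m hm => ?_⟩, hk⟩
  obtain ⟨i, hi, hi'⟩ := (Frequently.and_eventually hm he).exists
  exact hi ▸ hi'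

theorem evenLeast_of_parityCondition (h : p ∘ u ∈ parityCondition) : EvenLeast p u := by
  obtain ⟨k, ⟨hf, hl⟩, hk⟩ := h
  refine ⟨k, hk, hf, ?_⟩
  have h : ∀ m ∈ Finset.range k, ∀ᶠ i in atTop, p (u i) ≠ m := fun m hm =>
    not_frequently.1 fun hm' => (Finset.mem_range.1 hm).not_ge (hl hm')
  filter_upwards [(Filter.eventually_all_finset _).2 h] with i hi
  by_contra! hlt
  exact hi _ (Finset.mem_range.2 hlt) rfl

theorem meanPayoffCondition_of_goodInf (h : GoodInf r p u) : r ∘ u ∈ meanPayoffCondition := by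
  change (0 : EReal) ≤ limsup _ _
  refine le_of_forall_lt fun a ha => ?_
  obtain ⟨x, hax, hx⟩ := EReal.lt_iff_exists_real_btwn.1 ha
  have hx0 : x < 0 := by exact_mod_cast hx
  refine hax.trans_le (le_limsup_of_frequently_le (Eventually.frequently ?_))
  obtain ⟨K, hK⟩ := h.1 (-x / 2) (by linarith)
  -- The term `x / 2` accounts for averages of `n + 1` rewards being divided by `n`.
  obtain ⟨N, hN⟩ := exists_nat_ge ((K - x / 2) / (-x / 2))
  refine eventually_atTop.2 ⟨max N 1, fun n hn => EReal.coe_le_coe_iff.2 ?_⟩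
  have hn1 : (0 : ℝ) < n := by exact_mod_cast (by omega : 0 < n)
  have hNn : (N : ℝ) ≤ n := by exact_mod_cast (by omega : N ≤ n)
  have h1 := hN.trans hNn
  rw [div_le_iff₀ (by linarith)] at h1
  have h2 := hK (n + 1)
  push_cast at h2
  rw [one_div, inv_mul_eq_div, le_div_iff₀ hn1]
  simp only [Function.comp]
  linarith

theorem frequently_of_meanPayoffCondition (h : r ∘ u ∈ meanPayoffCondition) (ε : ℝ)
    (hε : 0 < ε) : ∃ᶠ n : ℕ in atTop, -ε * n ≤ ∑ i ∈ Finset.range n, r (u i) := by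
  have h1 : ((-ε : ℝ) : EReal) < limsup (fun n : ℕ =>
      (((1 / (n : ℝ)) * ∑ i ∈ Finset.range (n + 1), (r ∘ u) i : ℝ) : EReal)) atTop :=
    lt_of_lt_of_le (by exact_mod_cast neg_lt_zero.2 hε) h
  refine (tendsto_add_atTop_nat 1).frequently
    (((frequently_lt_of_lt_limsup (by isBoundedDefault) h1).and_eventually
      (eventually_ge_atTop 1)).mono fun n hn => ?_)
  have hn1 : (0 : ℝ) < n := by exact_mod_cast hn.2
  have h2 := EReal.coe_lt_coe_iff.1 hn.1
  rw [one_div, inv_mul_eq_div, lt_div_iff₀ hn1] at h2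
  simp only [Function.comp] at h2
  push_cast
  linarith

theorem mem_safetyMeanPayoffParity (hS : ∀ n, u n ∈ S) (h : GoodInf r p u) :
    u ∈ safetyMeanPayoffParity S r p :=
  ⟨hS, meanPayoffCondition_of_goodInf h, parityCondition_of_evenLeast h.2⟩

theorem goodSup_of_mem (h : u ∈ safetyMeanPayoffParity S r p) : GoodSup r p u :=
  ⟨frequently_of_meanPayoffCondition h.2.1, evenLeast_of_parityCondition h.2.2⟩

end WinningCondition

section Prefix

theorem wordPrefix_succ {X : Type*} (u : ℕ → X) (n : ℕ) :
    wordPrefix u (n + 1) = wordPrefix u n ++ [u n] := by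
  simp [wordPrefix, List.range_succ]

end Prefix

/-! ### Transfer to the game with colors -/

namespace ColorGame

variable {A₁ A₂ Q C : Type*} (g : ColorGame A₁ A₂ Q C) (S : Set C)

open Classical in
/-- A round of the game, in which an unsafe color leads to the sink `none`. -/
noncomputable def safeMove (q : Q) (a : A₁) (b : A₂) : Option C × Option Q :=
  if g.col q a b ∈ S then (some (g.col q a b), some (g.δ q a b)) else (none, none)

/-- The moves of the graph game with a sink. -/
def safeMoves : Option Q → Set (Option C × Option Q)
  | none => {(none, none)}
  | some q => {e | ∃ a b, g.safeMove S q a b = e}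

/-- The vertices of Player 1 in the graph game with a sink. -/
def safeOwn : Set (Option Q) := {v | ∀ q, v = some q → g.ControlledBy₁ q}

variable {g S}

theorem safeMove_of_mem {q : Q} {a : A₁} {b : A₂} (h : g.col q a b ∈ S) :
    g.safeMove S q a b = (some (g.col q a b), some (g.δ q a b)) := if_pos h

theorem safeMove_of_notMem {q : Q} {a : A₁} {b : A₂} (h : g.col q a b ∉ S) :
    g.safeMove S q a b = (none, none) := if_neg h

theorem ControlledBy₁.safeMove_eq {q : Q} (h : g.ControlledBy₁ q) (a : A₁) (b b' : A₂) :
    g.safeMove S q a b = g.safeMove S q a b' := by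
  rw [safeMove, safeMove, (h a b b').1, (h a b b').2]

theorem ControlledBy₂.safeMove_eq {q : Q} (h : g.ControlledBy₂ q) (a a' : A₁) (b : A₂) :
    g.safeMove S q a b = g.safeMove S q a' b := by
  rw [safeMove, safeMove, (h a a' b).1, (h a a' b).2]

theorem mem_safeOwn {q : Q} : some q ∈ g.safeOwn ↔ g.ControlledBy₁ q := by
  simp [safeOwn]

variable {r : C → ℝ} {p : C → ℕ}

/-- The sink repeats the odd priority `1` forever. -/
theorem not_wins_sink {M : Type} {σ : MemStrat (Option Q) (Option C) M} {m : M}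
    (hσ : ∀ m, ∀ v ∈ g.safeOwn, σ.act m v ∈ g.safeMoves S v) :
    ¬ σ.Wins (fun o => o.elim 0 r) (fun o => o.elim 1 p) g.safeOwn (g.safeMoves S) none m := by
  intro h
  obtain ⟨-, k, hk, hf, -⟩ := h (fun _ => none) (fun _ => none)
    (fun n => n.rec m fun _ m => σ.upd m none (none, none)) rfl rfl (fun _ => rfl)
    (fun n hn => (hσ _ _ hn).symm) fun _ => rfl
  obtain ⟨_, hi⟩ := hf.exists
  change 1 = k at hi
  exact absurd (hi ▸ hk) (by decide)

theorem exists_winning₁ [Nonempty A₁] [Nonempty A₂] (hW : g.W = safetyMeanPayoffParity S r p)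
    (h : Wins₁ (fun o => o.elim 0 r) (fun o => o.elim 1 p) g.safeOwn (g.safeMoves S)
      (some g.q₀)) : ∃ s : List A₂ → A₁, g.Winning₁ s := by
  classical
  obtain ⟨M, σ, m₀, hσ, hw⟩ := h
  have hact : ∀ (m : M) (q : Q), ∃ a : A₁, g.ControlledBy₁ q →
      ∀ b, g.safeMove S q a b = σ.act m (some q) := fun m q => by
    by_cases hq : g.ControlledBy₁ q
    · obtain ⟨a, b, hab⟩ := hσ m (some q) (mem_safeOwn.2 hq)
      exact ⟨a, fun _ b' => (hq.safeMove_eq a b' b).trans hab⟩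
    · exact ⟨Classical.arbitrary A₁, fun h => absurd h hq⟩
  choose act hact using hact
  let next : Q × M → A₂ → Q × M := fun x b =>
    (g.δ x.1 (act x.2 x.1) b, σ.upd x.2 (some x.1) (g.safeMove S x.1 (act x.2 x.1) b))
  let st : List A₂ → Q × M := fun l => l.foldl next (g.q₀, m₀)
  refine ⟨fun l => act (st l).2 (st l).1, fun β => ?_⟩
  have hst : ∀ n, st (wordPrefix β (n + 1)) = next (st (wordPrefix β n)) (β n) := fun n => by
    simp [st, wordPrefix_succ]
  set ρ := runOfStrategy₁ (fun l => act (st l).2 (st l).1) β with hρ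
  have hq : ∀ n, g.stateAt ρ n = (st (wordPrefix β n)).1 := fun n => by
    induction n with
    | zero => rfl
    | succ n ih => rw [stateAt, ih, hst]; rfl
  let μ : ℕ → M := fun n => (st (wordPrefix β n)).2
  let e : ℕ → Option C × Option Q := fun n => g.safeMove S (g.stateAt ρ n) (ρ n).1 (ρ n).2
  have ha : ∀ n, (ρ n).1 = act (μ n) (g.stateAt ρ n) := fun n => by rw [hq]; rfl
  have hμ : ∀ n, μ (n + 1) = σ.upd (μ n) (some (g.stateAt ρ n)) (e n) := fun n => by
    simp only [μ, e, hst, ha, hq]; rfl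
  have hmem : ∀ n, e n ∈ g.safeMoves S (some (g.stateAt ρ n)) := fun n => ⟨_, _, rfl⟩
  have hcons : ∀ n, some (g.stateAt ρ n) ∈ g.safeOwn →
      e n = σ.act (μ n) (some (g.stateAt ρ n)) := fun n hn => by
    simp only [e, ha]
    exact hact _ _ (mem_safeOwn.1 hn) _
  -- An unsafe color would lead a winning position into the sink.
  have hsafe : ∀ n, σ.Wins (fun o => o.elim 0 r) (fun o => o.elim 1 p) g.safeOwn
      (g.safeMoves S) (some (g.stateAt ρ n)) (μ n) → g.trace ρ n ∈ S := fun n h => by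
    by_contra hn
    have := h.step (hmem n) (hcons n)
    have he : e n = (none, none) := safeMove_of_notMem hn
    rw [he] at this
    exact not_wins_sink hσ this
  have he : ∀ n, g.trace ρ n ∈ S → e n = (some (g.trace ρ n), some (g.stateAt ρ (n + 1))) :=
    fun n hn => safeMove_of_mem hn
  have hwin : ∀ n, σ.Wins (fun o => o.elim 0 r) (fun o => o.elim 1 p) g.safeOwn
      (g.safeMoves S) (some (g.stateAt ρ n)) (μ n) := fun n => by
    induction n with
    | zero => exact hw
    | succ n ih =>
      have := ih.step (hmem n) (hcons n)
      rwa [← hμ, he n (hsafe n ih)] at this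
  have he' := fun n => he n (hsafe n (hwin n))
  rw [hW]
  exact mem_safetyMeanPayoffParity (fun n => hsafe n (hwin n))
    (hw (fun n => some (g.stateAt ρ n)) (fun n => some (g.trace ρ n)) μ rfl rfl
      (fun n => he' n ▸ hmem n) (fun n hn => he' n ▸ hcons n hn) fun n => he' n ▸ hμ n)

theorem exists_positional_winning₂ [Nonempty A₂] (hg : g.IsTurnBased)
    (hW : g.W = safetyMeanPayoffParity S r p)
    (h : Wins₂ (fun o => o.elim 0 r) (fun o => o.elim 1 p) g.safeOwn (g.safeMoves S)
      (some g.q₀)) : ∃ t : List A₁ → A₂, g.Positional₂ t ∧ g.Winning₂ t := by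
  obtain ⟨τ, hτ, hw⟩ := h
  -- Where Player 2 is in control, one action realizes the move `τ (some q)` against all actions of
  -- Player 1; elsewhere the action is irrelevant.
  have hb : ∀ q : Q, ∃ b : A₂, ¬ g.ControlledBy₁ q →
      ∀ a, g.safeMove S q a b = τ (some q) := fun q => by
    obtain ⟨a, b, hab⟩ := hτ (some q)
    exact ⟨b, fun hq a' => (((hg q).resolve_left hq).safeMove_eq a' a b).trans hab⟩
  choose bt hbt using hb
  let st : List A₁ → Q := fun l => l.foldl (fun q a => g.δ q a (bt q)) g.q₀
  have hst : ∀ α n, g.stateAt (runOfStrategy₂ (fun l => bt (st l)) α) n = st (wordPrefix α n) := by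
    intro α n
    induction n with
    | zero => rfl
    | succ n ih =>
      rw [stateAt, ih]
      simp [st, wordPrefix_succ, runOfStrategy₂]
  refine ⟨fun l => bt (st l), ⟨bt, fun α n => by rw [hst]⟩, fun α hα => ?_⟩
  rw [hW] at hα
  set ρ := runOfStrategy₂ (fun l => bt (st l)) α with hρ
  have he : ∀ n, g.safeMove S (g.stateAt ρ n) (ρ n).1 (ρ n).2 =
      (some (g.trace ρ n), some (g.stateAt ρ (n + 1))) := fun n => safeMove_of_mem (hα.1 n)
  have hb : ∀ n, (ρ n).2 = bt (g.stateAt ρ n) := fun n => by rw [hst]; rfl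
  refine hw (fun n => some (g.stateAt ρ n)) (fun n => some (g.trace ρ n)) rfl
    (fun n => ⟨_, _, he n⟩) (fun n hn => ?_)
    (show GoodSup r p (g.trace ρ) from goodSup_of_mem hα)
  rw [← he n, hb]
  exact hbt _ (fun h => hn (mem_safeOwn.2 h)) _

theorem safeMoves_nonempty [Nonempty A₁] [Nonempty A₂] (v : Option Q) :
    (g.safeMoves S v).Nonempty := by
  cases v with
  | none => exact ⟨_, rfl⟩
  | some q => exact ⟨_, Classical.arbitrary A₁, Classical.arbitrary A₂, rfl⟩

end ColorGame

theorem mainTheorem11 {A₁ A₂ Q C : Type*} [Nonempty A₁] [Nonempty A₂] [Finite Q] [Finite C]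
    (g : ColorGame A₁ A₂ Q C) (hg : g.IsTurnBased)
    (S : Set C) (r : C → ℝ) (p : C → ℕ) (hW : g.W = safetyMeanPayoffParity S r p) :
    g.HalfPositionallyDetermined :=
  (wins₁_or_wins₂ (fun o : Option C => o.elim 0 r) (fun o => o.elim 1 p) g.safeOwn
    (g.safeMoves S) ColorGame.safeMoves_nonempty (some g.q₀)).imp
    (ColorGame.exists_winning₁ hW) (ColorGame.exists_positional_winning₂ hg hW)
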